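/- Let $c>0$ and $\lambda>0$, let $N=(N(t))_{t\ge 0}$ be a homogeneous Poisson process with rate $\lambda$, and let $V(0)$ be a random variable independent of $N$ with $P\{V(0)=c\}=P\{V(0)=-c\}=\tfrac12$. Let $$\mathcal{T}(t)=\int_0^t V(0)(-1)^{N(s)}\,ds,\qquad t\ge 0,$$ be the symmetric telegraph process. Then for every integer $k\ge 1$, every $t>0$ and every $0<\beta<ct$, $$P\Bigl\{\max_{0\le s\le t}\mathcal{T}(s)<\beta \,\Big|\, V(0)=-c,\ N(t)=2k\Bigr\} =\frac{\beta}{ct}\sum_{j=0}^{k-1}\Bigl(\frac{c^2t^2-\beta^2}{c^2t^2}\Bigr)^j\frac{1}{2^{2j}}\binom{2j}{j}+\binom{2k}{k}\frac{(c^2t^2-\beta^2)^k}{(2ct)^{2k}},$$ and moreover $$P\Bigl\{\max_{0\le s\le t}\mathcal{T}(s)<\beta \,\Big|\, V(0)=-c,\ N(t)=2k\Bigr\} =P\Bigl\{\max_{0\le s\le t}\mathcal{T}(s)<\beta \,\Big|\, V(0)=c,\ N(t)=2k-1\Bigr\}+\binom{2k}{k}\frac{(c^2t^2-\beta^2)^k}{(2ct)^{2k}}.$$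 -/

import Mathlib

open MeasureTheory ProbabilityTheory
open scoped NNReal ENNReal

namespace Telegraph

/-- `N` is a homogeneous Poisson process of rate `r` on `[0, ∞)` under `P`: it counts the
renewals `T₁ < T₂ < …`, `Tₙ = ξ₀ + … + ξₙ₋₁`, of a sequence `ξ` of independent exponential
waiting times of parameter `r`, that is, almost surely `N(t) ≥ n ↔ Tₙ ≤ t` for all `t` and `n`. -/
def IsPoissonProcess {Ω : Type*} [MeasurableSpace Ω] (r : ℝ) (N : ℝ≥0 → Ω → ℕ)
    (P : Measure Ω) : Prop :=
  (∀ t, Measurable (N t)) ∧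
    ∃ ξ : ℕ → Ω → ℝ, (∀ i, Measurable (ξ i)) ∧ iIndepFun ξ P ∧
      (∀ i, P.map (ξ i) = expMeasure r) ∧
      ∀ᵐ ω ∂P, ∀ (t : ℝ≥0) (n : ℕ), n ≤ N t ω ↔ ∑ i ∈ Finset.range n, ξ i ω ≤ (t : ℝ)

/-- The telegraph process `𝒯(t) = ∫₀ᵗ V(0) (-1)^{N(s)} ds` with initial velocity `V₀`
and velocity reversals at the jumps of `N`. -/
noncomputable def telegraph {Ω : Type*} (V₀ : Ω → ℝ) (N : ℝ≥0 → Ω → ℕ) (t : ℝ≥0) (ω : Ω) : ℝ :=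
  ∫ s in (0 : ℝ)..(t : ℝ), V₀ ω * (-1) ^ N s.toNNReal ω

/-- The running maximum `max_{0 ≤ s ≤ t} X(s)` of a real process. -/
noncomputable def runningMax {Ω : Type*} (X : ℝ≥0 → Ω → ℝ) (t : ℝ≥0) (ω : Ω) : ℝ :=
  sSup ((fun s => X s ω) '' Set.Icc 0 t)

/-- The data of a symmetric telegraph process of speed `c` and rate `r`: `N` is a Poisson process
of rate `r`, the initial velocity takes the values `c` and `-c` with probability `1/2` each, and
it is independent of (the whole process) `N`. -/
structure IsSymmetricTelegraph {Ω : Type*} [MeasurableSpace Ω] (c r : ℝ) (V₀ : Ω → ℝ)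
    (N : ℝ≥0 → Ω → ℕ) (P : Measure Ω) : Prop where
  poisson : IsPoissonProcess r N P
  measurable_velocity : Measurable V₀
  prob_right : P {ω | V₀ ω = c} = 1 / 2
  prob_left : P {ω | V₀ ω = -c} = 1 / 2
  indep : IndepFun V₀ (fun ω t => N t ω) P

/-- The conditional probability `P{ max_{0 ≤ s ≤ t} 𝒯(s) < β | V(0) = v, N(t) = n }`. -/
noncomputable def condMaxCDF {Ω : Type*} [MeasurableSpace Ω] (P : Measure Ω) (V₀ : Ω → ℝ)
    (N : ℝ≥0 → Ω → ℕ) (t : ℝ≥0) (v : ℝ) (n : ℕ) (β : ℝ) : ℝ :=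
  (P[|{ω | V₀ ω = v ∧ N t ω = n}]).real {ω | runningMax (telegraph V₀ N) t ω < β}

end Telegraph

namespace Telegraph

/-! Dividing by `c` reduces to unit speed and barrier `b = β / c`. Conditioning on the first
reversal time `x` turns the event "n reversals up to `t`, path below `b`" into the same event with n
- 1 reversals, velocity `-v`, barrier `b - v * x` and horizon `t - x`. Integrating over exponential
waiting times, its probability is `r ^ n * exp (-(r * t)) * F / n!` with F a polynomial in `b` and
`t`; dividing by the Poisson weight `r ^ n * exp (-(r * t)) * t ^ n / n!` leaves `F / t ^ n`, free
of the rate.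

The polynomials are `upFactor` (start upwards, 2k - 1 reversals) and `downFactor` (start downwards,
2k reversals). Each is, up to a constant, an antiderivative of the other along the line on which
(barrier, horizon) moves during the first flight: `hasDerivAt_upFactor` and `hasDerivAt_downFactor`.
Hence they solve the integral recursion (`belowMeasure_up`, `belowMeasure_down`). Unrolling
`upFactor` gives the sum over j; the definition of `downFactor` gives the second identity. -/

/-! ### Paths as functions of their waiting times -/

/-- The waiting times `x` produce exactly `n` velocity reversals up to time `t`, and the path with
initial velocity `v` which they determine stays below `b` on `[0, t]`. -/
def PathBelow : (n : ℕ) → (v b t : ℝ) → (Fin (n + 1) → ℝ) → Prop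
  | 0, v, b, t, x => t < x 0 ∧ 0 < b ∧ v * t < b
  | n + 1, v, b, t, x =>
      x 0 ≤ t ∧ 0 < b ∧ v * x 0 < b ∧ PathBelow n (-v) (b - v * x 0) (t - x 0) (Fin.tail x)

lemma pathBelow_scale {c : ℝ} (hc : 0 < c) (n : ℕ) (v b t : ℝ) (x : Fin (n + 1) → ℝ) :
    PathBelow n (c * v) (c * b) t x ↔ PathBelow n v b t x := by
  induction n generalizing v b t with
  | zero => simp only [PathBelow, mul_assoc, mul_lt_mul_iff_right₀ hc, mul_pos_iff_of_pos_left hc]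
  | succ n ih =>
    have h1 : -(c * v) = c * -v := by ring
    have h2 : c * b - c * (v * x 0) = c * (b - v * x 0) := by ring
    simp only [PathBelow, mul_assoc, mul_lt_mul_iff_right₀ hc, mul_pos_iff_of_pos_left hc, h1, h2,
      ih]

/-- `f` is a counting function on `[0, ∞)` with waiting times `x`. -/
def Counts (f : ℝ → ℕ) (x : ℕ → ℝ) : Prop :=
  Monotone f ∧ (∀ i, 0 < x i) ∧
    ∀ s, 0 ≤ s → ∀ m, m ≤ f s ↔ ∑ i ∈ Finset.range m, x i ≤ s

/-- Restart at the first renewal. The truncated subtraction is harmless: the count is at least 1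
there when `0 ≤ s`. -/
lemma Counts.shift {f : ℝ → ℕ} {x : ℕ → ℝ} (h : Counts f x) :
    Counts (fun s => f (s + x 0) - 1) (fun i => x (i + 1)) := by
  obtain ⟨hm, hx, hf⟩ := h
  refine ⟨fun a b hab => Nat.sub_le_sub_right (hm (by linarith)) 1, fun i => hx _, ?_⟩
  intro s hs m
  have h1 : 1 ≤ f (s + x 0) := (hf _ (by linarith [hx 0]) 1).2 (by simpa using hs)
  have h2 := hf (s + x 0) (by linarith [hx 0]) (m + 1)
  rw [Finset.sum_range_succ', add_le_add_iff_right] at h2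
  rw [← h2]
  change m ≤ f (s + x 0) - 1 ↔ _
  omega

lemma Counts.eq_zero_of_lt {f : ℝ → ℕ} {x : ℕ → ℝ} (h : Counts f x) {s : ℝ} (hs : 0 ≤ s)
    (hsx : s < x 0) : f s = 0 := by
  by_contra h0
  have := (h.2.2 s hs 1).1 (by omega)
  simp at this
  linarith

lemma intervalIntegrable_reversals {f : ℝ → ℕ} (hf : Monotone f) (v a b : ℝ) :
    IntervalIntegrable (fun s => v * (-1) ^ f s) volume a b := by
  have hm : Measurable fun s => v * (-1 : ℝ) ^ f s :=
    (measurable_from_top (f := fun n : ℕ => v * (-1 : ℝ) ^ n)).comp hf.measurable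
  rw [intervalIntegrable_iff]
  refine Measure.integrableOn_of_bounded (M := |v|) (by simp) hm.aestronglyMeasurable ?_
  exact Filter.Eventually.of_forall fun s => by simp

lemma Counts.integral_of_le {f : ℝ → ℕ} {x : ℕ → ℝ} (h : Counts f x) (v : ℝ) {s : ℝ} (hs : 0 ≤ s)
    (hsx : s ≤ x 0) : ∫ u in (0 : ℝ)..s, v * (-1) ^ f u = v * s := by
  have : ∫ u in (0 : ℝ)..s, v * (-1) ^ f u = ∫ u in (0 : ℝ)..s, v := by
    rw [intervalIntegral.integral_of_le hs, intervalIntegral.integral_of_le hs,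
      integral_Ioc_eq_integral_Ioo, integral_Ioc_eq_integral_Ioo]
    refine setIntegral_congr_fun measurableSet_Ioo fun u hu => ?_
    simp [h.eq_zero_of_lt hu.1.le (hu.2.trans_le hsx)]
  rw [this]
  simp [mul_comm]

lemma Counts.integral_add {f : ℝ → ℕ} {x : ℕ → ℝ} (h : Counts f x) (v : ℝ) {s : ℝ} (hs : 0 ≤ s) :
    ∫ u in (0 : ℝ)..(s + x 0), v * (-1) ^ f u
      = v * x 0 + ∫ u in (0 : ℝ)..s, -v * (-1) ^ (f (u + x 0) - 1) := by
  rw [← intervalIntegral.integral_add_adjacent_intervals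
    (intervalIntegrable_reversals h.1 v 0 (x 0)) (intervalIntegrable_reversals h.1 v (x 0) _),
    h.integral_of_le v (h.2.1 0).le le_rfl]
  congr 1
  have h1 := intervalIntegral.integral_comp_add_right (a := 0) (b := s)
    (fun u => v * (-1 : ℝ) ^ f u) (x 0)
  rw [zero_add] at h1
  rw [← h1]
  refine intervalIntegral.integral_congr fun u hu => ?_
  rw [Set.uIcc_of_le hs] at hu
  have h2 : 1 ≤ f (u + x 0) :=
    (h.2.2 _ (by linarith [h.2.1 0, hu.1]) 1).2 (by simpa using hu.1)
  obtain ⟨m, hm⟩ := Nat.exists_eq_add_of_le' h2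
  simp [hm, pow_succ]

/-- A linear flight is highest at one of its endpoints; this is why `PathBelow` tests only these. -/
lemma forall_mul_lt_iff {v b a : ℝ} (ha : 0 ≤ a) :
    (∀ s ∈ Set.Icc 0 a, v * s < b) ↔ 0 < b ∧ v * a < b := by
  constructor
  · intro h
    exact ⟨by simpa using h 0 ⟨le_rfl, ha⟩, h a ⟨ha, le_rfl⟩⟩
  · rintro ⟨h0, h1⟩ s ⟨hs0, hs1⟩
    rcases le_total 0 v with hv | hv
    · exact (mul_le_mul_of_nonneg_left hs1 hv).trans_lt h1
    · exact (mul_nonpos_of_nonpos_of_nonneg hv hs0).trans_lt h0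

/-- Induction by splitting the path at `x 0`: a linear flight, then the restarted path with opposite
velocity, seen from the position `v * x 0`. -/
lemma Counts.pathBelow_iff {f : ℝ → ℕ} {x : ℕ → ℝ} (h : Counts f x) (n : ℕ) (v b : ℝ) {t : ℝ}
    (ht : 0 ≤ t) :
    PathBelow n v b t (fun i => x i) ↔
      f t = n ∧ ∀ s ∈ Set.Icc 0 t, ∫ u in (0 : ℝ)..s, v * (-1) ^ f u < b := by
  induction n generalizing f x v b t with
  | zero =>
    have hft : f t = 0 ↔ t < x 0 := by
      refine ⟨fun h0 => ?_, h.eq_zero_of_lt ht⟩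
      by_contra! hlt
      have := (h.2.2 t ht 1).2 (by simpa using hlt)
      omega
    simp only [PathBelow, hft, Fin.val_zero]
    refine and_congr_right fun hlt => ?_
    rw [← forall_mul_lt_iff ht]
    refine forall₂_congr fun s hs => ?_
    rw [h.integral_of_le v hs.1 (hs.2.trans hlt.le)]
  | succ n ih =>
    simp only [PathBelow, Fin.val_zero]
    by_cases hxt : x 0 ≤ t
    · have h1 : 1 ≤ f t := (h.2.2 t ht 1).2 (by simpa using hxt)
      have ih' := ih h.shift (-v) (b - v * x 0) (t := t - x 0) (by linarith)
      have htail : Fin.tail (fun i : Fin (n + 1 + 1) => x i) = fun i : Fin (n + 1) => x (i + 1) := by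
        ext i; simp [Fin.tail]
      rw [htail, ih', sub_add_cancel, ← and_assoc (a := 0 < b),
        ← forall_mul_lt_iff (h.2.1 0).le]
      have hn : f t - 1 = n ↔ f t = n + 1 := by omega
      rw [hn]
      simp only [hxt, true_and]
      rw [and_left_comm]
      refine and_congr_right fun _ => ⟨?_, fun H => ⟨?_, ?_⟩⟩
      · rintro ⟨H1, H2⟩ s hs
        rcases le_total s (x 0) with hsx | hsx
        · rw [h.integral_of_le v hs.1 hsx]
          exact H1 s ⟨hs.1, hsx⟩
        · have := H2 (s - x 0) ⟨by linarith, by linarith [hs.2]⟩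
          have h3 := h.integral_add v (s := s - x 0) (by linarith)
          rw [sub_add_cancel] at h3
          linarith
      · intro s hs
        have := H s ⟨hs.1, hs.2.trans hxt⟩
        rwa [h.integral_of_le v hs.1 hs.2] at this
      · intro s hs
        have := H (s + x 0) ⟨by linarith [h.2.1 0, hs.1], by linarith [hs.2]⟩
        rw [h.integral_add v hs.1] at this
        linarith
    · have h0 : f t = 0 := h.eq_zero_of_lt ht (not_le.1 hxt)
      simp [hxt, h0]

/-! ### Integral recursion over the first waiting time -/

/-- Measurability is proved jointly in barrier, horizon and waiting times because the recursion
moves the first two by amounts depending on `x 0`. -/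
lemma measurableSet_pathBelow_joint (n : ℕ) (v : ℝ) :
    MeasurableSet {p : ℝ × ℝ × (Fin (n + 1) → ℝ) | PathBelow n v p.1 p.2.1 p.2.2} := by
  induction n generalizing v with
  | zero =>
    simp only [PathBelow, Set.ofPred_and]
    refine (measurableSet_lt (by fun_prop) (by fun_prop)).inter
      ((measurableSet_lt (by fun_prop) (by fun_prop)).inter
        (measurableSet_lt (by fun_prop) (by fun_prop)))
  | succ n ih =>
    simp only [PathBelow, Set.ofPred_and]
    refine (measurableSet_le (by fun_prop) (by fun_prop)).inter
      ((measurableSet_lt (by fun_prop) (by fun_prop)).inter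
        ((measurableSet_lt (by fun_prop) (by fun_prop)).inter ?_))
    have hm : Measurable fun p : ℝ × ℝ × (Fin (n + 1 + 1) → ℝ) =>
        (p.1 - v * p.2.2 0, p.2.1 - p.2.2 0, (Fin.tail p.2.2 : Fin (n + 1) → ℝ)) := by
      refine Measurable.prodMk (by fun_prop) (Measurable.prodMk (by fun_prop) ?_)
      exact measurable_pi_lambda _ fun i => by unfold Fin.tail; fun_prop
    exact hm (ih (-v))

lemma measurableSet_pathBelow (n : ℕ) (v b t : ℝ) : MeasurableSet {x | PathBelow n v b t x} :=
  (by fun_prop : Measurable fun x : Fin (n + 1) → ℝ => (b, t, x))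
    (measurableSet_pathBelow_joint n v)

lemma measurableSet_admissible (v b t : ℝ) :
    MeasurableSet {x : ℝ | x ≤ t ∧ 0 < b ∧ v * x < b} := by
  simp only [Set.ofPred_and]
  exact (measurableSet_le (by fun_prop) (by fun_prop)).inter
    ((measurableSet_lt (by fun_prop) (by fun_prop)).inter
      (measurableSet_lt (by fun_prop) (by fun_prop)))

/-- The probability of `PathBelow` for independent exponential waiting times. -/
noncomputable def belowMeasure (r : ℝ) (n : ℕ) (v b t : ℝ) : ℝ≥0∞ :=
  Measure.pi (fun _ : Fin (n + 1) => expMeasure r) {x | PathBelow n v b t x}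

lemma belowMeasure_succ {r : ℝ} (hr : 0 < r) (n : ℕ) (v b t : ℝ) :
    belowMeasure r (n + 1) v b t = ∫⁻ x in {x | x ≤ t ∧ 0 < b ∧ v * x < b},
      belowMeasure r n (-v) (b - v * x) (t - x) ∂(expMeasure r) := by
  have := isProbabilityMeasure_expMeasure hr
  have hmp := measurePreserving_piFinSuccAbove (fun _ : Fin (n + 1 + 1) => expMeasure r) 0
  have hA := measurableSet_admissible v b t
  let S : Set (ℝ × (Fin (n + 1) → ℝ)) :=
    {p | p.1 ∈ {x : ℝ | x ≤ t ∧ 0 < b ∧ v * x < b} ∧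
      PathBelow n (-v) (b - v * p.1) (t - p.1) p.2}
  have hS : MeasurableSet S := by
    simp only [S, Set.ofPred_and]
    refine (measurable_fst hA).inter ?_
    exact (by fun_prop : Measurable fun p : ℝ × (Fin (n + 1) → ℝ) =>
      (b - v * p.1, t - p.1, p.2)) (measurableSet_pathBelow_joint n (-v))
  have hpre : {x | PathBelow (n + 1) v b t x}
      = MeasurableEquiv.piFinSuccAbove (fun _ : Fin (n + 1 + 1) => ℝ) 0 ⁻¹' S := by
    ext x
    simp only [Set.mem_ofPred_eq, PathBelow, Set.mem_preimage, S, and_assoc]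
    rfl
  rw [belowMeasure, hpre, hmp.measure_preimage hS.nullMeasurableSet, Measure.prod_apply hS,
    ← lintegral_indicator hA]
  refine lintegral_congr fun x => ?_
  by_cases hx : x ∈ {x : ℝ | x ≤ t ∧ 0 < b ∧ v * x < b}
  · rw [Set.indicator_of_mem hx, belowMeasure]
    congr 1
    ext y
    simp only [Set.mem_preimage, Set.mem_ofPred_eq, S]
    exact and_iff_right hx
  · rw [Set.indicator_of_notMem hx]
    convert measure_empty
    · ext y
      simp only [Set.mem_preimage, Set.mem_ofPred_eq, S, Set.mem_empty_iff_false, iff_false]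
      exact fun h => hx h.1
    · infer_instance

lemma belowMeasure_zero {r : ℝ} (hr : 0 < r) {v b t : ℝ} (ht : 0 ≤ t) (hb : 0 < b)
    (hvt : v * t < b) : belowMeasure r 0 v b t = ENNReal.ofReal (Real.exp (-(r * t))) := by
  have := isProbabilityMeasure_expMeasure hr
  have h1 : {x : Fin 1 → ℝ | PathBelow 0 v b t x} = Function.eval 0 ⁻¹' Set.Ioi t := by
    ext x; simp [PathBelow, hb, hvt]
  rw [belowMeasure, h1, (measurePreserving_eval (fun _ : Fin 1 => expMeasure r) 0).measure_preimage
    measurableSet_Ioi.nullMeasurableSet, ← Set.compl_Iic, ← ofReal_measureReal,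
    probReal_compl_eq_one_sub measurableSet_Iic, ← cdf_eq_real, cdf_expMeasure_eq hr, if_pos ht]
  congr 1
  ring

/-- One step of the recursion for `belowMeasure`, in terms of the density factor that remains
after `rⁿ e^{-rt}` is split off. -/
lemma belowMeasure_succ_eq {r : ℝ} (hr : 0 < r) (n : ℕ) {v b t u : ℝ} (hu : 0 ≤ u)
    (hset : ∀ x, 0 < x → x ≠ u → ((x ≤ t ∧ 0 < b ∧ v * x < b) ↔ x < u)) {φ : ℝ → ℝ}
    (hint : IntervalIntegrable φ volume 0 u) (hpos : ∀ x ∈ Set.Ioo 0 u, 0 ≤ φ x) (z : ℝ)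
    (hφ : ∀ x ∈ Set.Ioo 0 u, x ≠ z → belowMeasure r n (-v) (b - v * x) (t - x)
      = ENNReal.ofReal (r ^ n * Real.exp (-(r * (t - x))) * φ x)) :
    belowMeasure r (n + 1) v b t
      = ENNReal.ofReal (r ^ (n + 1) * Real.exp (-(r * t)) * ∫ x in (0 : ℝ)..u, φ x) := by
  have hA := measurableSet_admissible v b t
  have hK : 0 ≤ r ^ (n + 1) * Real.exp (-(r * t)) := by positivity
  have hint' : Integrable φ (volume.restrict (Set.Ioo 0 u)) :=
    ((intervalIntegrable_iff_integrableOn_Ioo_of_le hu).1 hint)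
  rw [belowMeasure_succ hr, ← lintegral_indicator hA]
  have hexp : expMeasure r = volume.withDensity (exponentialPDF r) := rfl
  have hmeas : Measurable (exponentialPDF r) := (measurable_exponentialPDFReal r).ennreal_ofReal
  -- The density is finite everywhere, so measurability of `belowMeasure` in `x` is not needed.
  rw [hexp, lintegral_withDensity_eq_lintegral_mul_non_measurable _ hmeas
    (Filter.Eventually.of_forall fun x => by simp [exponentialPDF])]
  rw [intervalIntegral.integral_of_le hu, integral_Ioc_eq_integral_Ioo, ← integral_const_mul,
    ofReal_integral_eq_lintegral_ofReal (hint'.const_mul _)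
      ((ae_restrict_iff' measurableSet_Ioo).2 (Filter.Eventually.of_forall fun x hx =>
        mul_nonneg hK (hpos x hx))), ← lintegral_indicator measurableSet_Ioo]
  refine lintegral_congr_ae ?_
  have hne : ∀ a : ℝ, ∀ᵐ x : ℝ, x ≠ a := fun a => by
    simp [ae_iff]
  filter_upwards [hne 0, hne u, hne z] with x hx0 hxu hxz
  simp only [Pi.mul_apply]
  rcases lt_or_gt_of_ne hx0 with hneg | hxpos
  · rw [exponentialPDF_of_neg hneg, zero_mul, Set.indicator_of_notMem]
    exact fun h => absurd h.1 (not_lt.2 hneg.le)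
  · by_cases hxlt : x < u
    · rw [Set.indicator_of_mem (show x ∈ {x : ℝ | x ≤ t ∧ 0 < b ∧ v * x < b} from
        (hset x hxpos hxu).2 hxlt), Set.indicator_of_mem (Set.mem_Ioo.2 ⟨hxpos, hxlt⟩),
        hφ x ⟨hxpos, hxlt⟩ hxz, exponentialPDF_of_nonneg hxpos.le,
        ← ENNReal.ofReal_mul (by positivity)]
      congr 1
      have : Real.exp (-(r * t)) = Real.exp (-(r * x)) * Real.exp (-(r * (t - x))) := by
        rw [← Real.exp_add]; congr 1; ring
      rw [this]
      ring
    · rw [Set.indicator_of_notMem (show x ∉ {x : ℝ | x ≤ t ∧ 0 < b ∧ v * x < b} from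
          fun h => hxlt ((hset x hxpos hxu).1 h)),
        Set.indicator_of_notMem (show x ∉ Set.Ioo 0 u from fun h => hxlt h.2), mul_zero]

/-! ### The polynomial factors and their derivatives -/

/-- The normalised central binomial coefficient `4⁻ʲ (2j choose j)`. -/
noncomputable def centralCoeff (j : ℕ) : ℝ := (j.centralBinom : ℝ) / 4 ^ j

lemma centralCoeff_zero : centralCoeff 0 = 1 := by simp [centralCoeff]

lemma centralCoeff_succ (j : ℕ) :
    2 * ((j : ℝ) + 1) * centralCoeff (j + 1) = (2 * j + 1) * centralCoeff j := by
  have h : ((j : ℝ) + 1) * ((j + 1).centralBinom : ℝ) = 2 * (2 * j + 1) * (j.centralBinom : ℝ) := by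
    exact_mod_cast Nat.succ_mul_centralBinom_succ j
  have h4 : (4 : ℝ) ^ j ≠ 0 := by positivity
  unfold centralCoeff
  rw [pow_succ]
  field_simp
  linear_combination 2 * h

lemma centralCoeff_nonneg (j : ℕ) : 0 ≤ centralCoeff j := by unfold centralCoeff; positivity

/-- `(2k-1)!` times the volume factor of the paths that start upwards, reverse `2k-1` times
and stay below `b` on `[0, t]`. -/
noncomputable def upFactor : ℕ → ℝ → ℝ → ℝ
  | 0, _, _ => 0
  | k + 1, b, t => t ^ 2 * upFactor k b t + b * (t ^ 2 - b ^ 2) ^ k * centralCoeff k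

/-- `(2k)!` times the volume factor of the paths that start downwards, reverse `2k` times
and stay below `b` on `[0, t]`. -/
noncomputable def downFactor (k : ℕ) (b t : ℝ) : ℝ :=
  t * upFactor k b t + centralCoeff k * (t ^ 2 - b ^ 2) ^ k

lemma upFactor_zero_left (k : ℕ) (t : ℝ) : upFactor k 0 t = 0 := by
  induction k with
  | zero => rfl
  | succ k ih => simp [upFactor, ih]

/-- On the diagonal every term containing `t ^ 2 - b ^ 2` vanishes. The value agrees with the
unrestricted factor, so the two regimes in `belowMeasure_down_succ` glue continuously. -/
lemma upFactor_self (k : ℕ) (t : ℝ) : upFactor (k + 1) t t = t ^ (2 * k + 1) := by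
  induction k with
  | zero => simp [upFactor, centralCoeff_zero]
  | succ k ih =>
    rw [upFactor, ih]
    simp
    ring

lemma downFactor_self (k : ℕ) (t : ℝ) : downFactor (k + 1) t t = t ^ (2 * k + 2) := by
  rw [downFactor, upFactor_self]
  simp
  ring

lemma upFactor_nonneg (k : ℕ) {b t : ℝ} (hb : 0 ≤ b) (hbt : b ≤ t) : 0 ≤ upFactor k b t := by
  have hX : 0 ≤ t ^ 2 - b ^ 2 := by nlinarith
  induction k with
  | zero => exact le_rfl
  | succ k ih =>
    have := centralCoeff_nonneg k
    rw [upFactor]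
    positivity

lemma downFactor_nonneg (k : ℕ) {b t : ℝ} (hb : 0 ≤ b) (hbt : b ≤ t) : 0 ≤ downFactor k b t := by
  have hX : 0 ≤ t ^ 2 - b ^ 2 := by nlinarith
  have h1 := centralCoeff_nonneg k
  have h2 := upFactor_nonneg k hb hbt
  have h3 : 0 ≤ t := hb.trans hbt
  rw [downFactor]
  positivity

lemma hasDerivAt_sub_sq_sub_sq (b t s : ℝ) :
    HasDerivAt (fun s : ℝ => (t - s) ^ 2 - (b - s) ^ 2) (-(2 * (t - s) - 2 * (b - s))) s := by
  have h1 := (((hasDerivAt_id s).const_sub t).pow 2).sub (((hasDerivAt_id s).const_sub b).pow 2)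
  refine h1.congr_deriv ?_
  simp
  ring

lemma hasDerivAt_sub_sq_add_sq (b t s : ℝ) :
    HasDerivAt (fun s : ℝ => (t - s) ^ 2 - (b + s) ^ 2) (-(2 * (t - s) + 2 * (b + s))) s := by
  have h1 := (((hasDerivAt_id s).const_sub t).pow 2).sub (((hasDerivAt_id s).const_add b).pow 2)
  refine h1.congr_deriv ?_
  simp
  ring

/-- During an upward flight barrier and horizon shrink together. The new terms at each induction
step match by `centralCoeff_succ`. -/
lemma hasDerivAt_upFactor (k : ℕ) (b t s : ℝ) :
    HasDerivAt (fun s => upFactor (k + 1) (b - s) (t - s))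
      (-((2 * k + 1) * downFactor k (b - s) (t - s))) s := by
  have hb : HasDerivAt (fun s : ℝ => b - s) (-1) s := by simpa using (hasDerivAt_id s).const_sub b
  have ht : HasDerivAt (fun s : ℝ => t - s) (-1) s := by simpa using (hasDerivAt_id s).const_sub t
  induction k with
  | zero => simpa [upFactor, downFactor, centralCoeff_zero] using hb
  | succ k ih =>
    have h := ((ht.pow 2).mul ih).add
      ((hb.mul ((hasDerivAt_sub_sq_sub_sq b t s).pow (k + 1))).mul_const (centralCoeff (k + 1)))
    have hc := centralCoeff_succ k
    refine h.congr_deriv ?_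
    simp only [downFactor, upFactor, Nat.add_sub_cancel, Pi.pow_apply]
    push_cast
    generalize b - s = B
    generalize t - s = T
    generalize upFactor k B T = a at *
    generalize centralCoeff k = c0 at *
    generalize centralCoeff (k + 1) = c1 at *
    rw [pow_succ (T ^ 2 - B ^ 2) k]
    generalize (T ^ 2 - B ^ 2) ^ k = Y
    linear_combination (Y * (T ^ 2 - B * T)) * hc

/-- During a downward flight the barrier recedes while the horizon shrinks. -/
lemma hasDerivAt_downFactor (k : ℕ) (b t s : ℝ) :
    HasDerivAt (fun s => downFactor k (b + s) (t - s))
      (-(2 * k * upFactor k (b + s) (t - s))) s := by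
  have hb : HasDerivAt (fun s : ℝ => b + s) 1 s := by simpa using (hasDerivAt_id s).const_add b
  have ht : HasDerivAt (fun s : ℝ => t - s) (-1) s := by simpa using (hasDerivAt_id s).const_sub t
  have hX := hasDerivAt_sub_sq_add_sq b t s
  induction k with
  | zero => simpa [downFactor, upFactor, centralCoeff_zero] using hasDerivAt_const s (1 : ℝ)
  | succ k ih =>
    -- `upFactor` is eliminated in favour of `downFactor k`, the only one whose derivative along
    -- this line is known by induction.
    have hfun : (fun s => downFactor (k + 1) (b + s) (t - s)) = fun s =>
        (t - s) ^ 2 * downFactor k (b + s) (t - s)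
          - (t - s) * (t - s - (b + s)) * ((t - s) ^ 2 - (b + s) ^ 2) ^ k * centralCoeff k
          + ((t - s) ^ 2 - (b + s) ^ 2) ^ (k + 1) * centralCoeff (k + 1) := by
      funext s
      simp only [downFactor, upFactor]
      ring
    have h := (((ht.pow 2).mul ih).sub (((ht.mul (ht.sub hb)).mul (hX.pow k)).mul_const
      (centralCoeff k))).add ((hX.pow (k + 1)).mul_const (centralCoeff (k + 1)))
    have hc := centralCoeff_succ k
    rw [hfun]
    refine h.congr_deriv ?_
    simp only [downFactor, upFactor, Nat.add_sub_cancel, Pi.pow_apply, Pi.sub_apply, Pi.mul_apply]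
    push_cast
    generalize b + s = B
    generalize t - s = T
    generalize upFactor k B T = a at *
    generalize centralCoeff k = c0 at *
    generalize centralCoeff (k + 1) = c1 at *
    -- Differentiating the k-th power produces the exponent `k - 1`, so `k = 0` is separate.
    cases k with
    | zero =>
      simp only [pow_zero] at hc ⊢
      push_cast at hc ⊢
      linear_combination -(T + B) * hc
    | succ m =>
      simp only [Nat.add_sub_cancel]
      push_cast at hc ⊢
      rw [pow_succ (T ^ 2 - B ^ 2) m]
      generalize (T ^ 2 - B ^ 2) ^ m = Y
      linear_combination (-(T + B) * Y * (T ^ 2 - B ^ 2)) * hc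

lemma continuous_upFactor (k : ℕ) : Continuous fun p : ℝ × ℝ => upFactor k p.1 p.2 := by
  induction k with
  | zero => exact continuous_const
  | succ k ih => simp only [upFactor]; fun_prop

lemma continuous_downFactor (k : ℕ) : Continuous fun p : ℝ × ℝ => downFactor k p.1 p.2 := by
  have := continuous_upFactor k
  simp only [downFactor]
  fun_prop

/-! ### Solving the recursion -/

lemma hasDerivAt_sub_pow_div_factorial (n : ℕ) (t s : ℝ) :
    HasDerivAt (fun s : ℝ => -((t - s) ^ (n + 1) / (n + 1).factorial))
      ((t - s) ^ n / n.factorial) s := by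
  have ht : HasDerivAt (fun s : ℝ => t - s) (-1) s := by simpa using (hasDerivAt_id s).const_sub t
  refine ((ht.pow (n + 1)).div_const ((n + 1).factorial : ℝ)).neg.congr_deriv ?_
  rw [Nat.factorial_succ]
  push_cast
  have : (n.factorial : ℝ) ≠ 0 := by positivity
  simp
  field_simp

lemma integral_sub_pow_div_factorial (n : ℕ) (z t : ℝ) :
    ∫ x in z..t, (t - x) ^ n / n.factorial = (t - z) ^ (n + 1) / (n + 1).factorial := by
  rw [intervalIntegral.integral_eq_sub_of_hasDerivAt
    (fun x _ => hasDerivAt_sub_pow_div_factorial n t x)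
    (Continuous.intervalIntegrable (by fun_prop) _ _)]
  simp

/-- At speed at most 1 a barrier beyond `t` is out of reach, so only the Poisson weight of n
reversals remains. -/
lemma belowMeasure_of_lt {r : ℝ} (hr : 0 < r) (n : ℕ) {v b t : ℝ} (hv : |v| ≤ 1) (ht : 0 ≤ t)
    (htb : t < b) : belowMeasure r n v b t
      = ENNReal.ofReal (r ^ n * Real.exp (-(r * t)) * (t ^ n / n.factorial)) := by
  induction n generalizing v b t with
  | zero =>
    rw [belowMeasure_zero hr ht (ht.trans_lt htb)]
    · simp
    · nlinarith [le_abs_self v]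
  | succ n ih =>
    have hv1 := (abs_le.1 hv).2
    have hI := integral_sub_pow_div_factorial n 0 t
    rw [sub_zero] at hI
    rw [← hI]
    refine belowMeasure_succ_eq hr n ht ?_ (Continuous.intervalIntegrable (by fun_prop) _ _) ?_ 0 ?_
    · intro x hx hxt
      refine ⟨fun h => lt_of_le_of_ne h.1 hxt, fun h => ⟨h.le, ht.trans_lt htb, ?_⟩⟩
      nlinarith
    · intro x hx
      have : 0 ≤ t - x := by linarith [hx.2]
      positivity
    · intro x hx _
      refine ih (by rwa [abs_neg]) (by linarith [hx.2]) ?_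
      nlinarith [hx.1]

lemma belowMeasure_up {r : ℝ} (hr : 0 < r) (k : ℕ) {b t : ℝ} (hb : 0 < b) (hbt : b < t)
    (ih : ∀ {b t : ℝ}, 0 < b → b < t → belowMeasure r (2 * k) (-1) b t
      = ENNReal.ofReal (r ^ (2 * k) * Real.exp (-(r * t))
          * (downFactor k b t / (2 * k).factorial))) :
    belowMeasure r (2 * k + 1) 1 b t
      = ENNReal.ofReal (r ^ (2 * k + 1) * Real.exp (-(r * t))
          * (upFactor (k + 1) b t / (2 * k + 1).factorial)) := by
  have hcont : Continuous fun x => downFactor k (b - x) (t - x) / (2 * k).factorial :=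
    ((continuous_downFactor k).comp
      (by fun_prop : Continuous fun x : ℝ => (b - x, t - x))).div_const _
  have hI : ∫ x in (0 : ℝ)..b, downFactor k (b - x) (t - x) / (2 * k).factorial
      = upFactor (k + 1) b t / (2 * k + 1).factorial := by
    rw [intervalIntegral.integral_eq_sub_of_hasDerivAt
      (f := fun x => -(upFactor (k + 1) (b - x) (t - x) / (2 * k + 1).factorial)) _
      (hcont.intervalIntegrable _ _)]
    · simp [upFactor_zero_left]
    · intro x _
      refine ((hasDerivAt_upFactor k b t x).div_const
        ((2 * k + 1).factorial : ℝ)).neg.congr_deriv ?_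
      rw [Nat.factorial_succ]
      have : ((2 * k).factorial : ℝ) ≠ 0 := by positivity
      push_cast
      field_simp
  rw [← hI]
  -- The first reversal must occur before time `b`, when the upward flight would hit the barrier.
  refine belowMeasure_succ_eq hr (2 * k) hb.le ?_ (hcont.intervalIntegrable _ _) ?_ 0 ?_
  · intro x hx hxb
    exact ⟨fun h => by linarith [h.2.2], fun h => ⟨by linarith, hb, by linarith⟩⟩
  · intro x hx
    have := downFactor_nonneg k (b := b - x) (t := t - x) (by linarith [hx.2]) (by linarith)
    positivity
  · intro x hx _
    rw [one_mul]
    exact ih (by linarith [hx.2]) (by linarith)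

lemma belowMeasure_down_succ {r : ℝ} (hr : 0 < r) (k : ℕ) {b t : ℝ} (hb : 0 < b) (hbt : b < t)
    (ih : ∀ {b t : ℝ}, 0 < b → b < t → belowMeasure r (2 * k + 1) 1 b t
      = ENNReal.ofReal (r ^ (2 * k + 1) * Real.exp (-(r * t))
          * (upFactor (k + 1) b t / (2 * k + 1).factorial))) :
    belowMeasure r (2 * k + 2) (-1) b t
      = ENNReal.ofReal (r ^ (2 * k + 2) * Real.exp (-(r * t))
          * (downFactor (k + 1) b t / (2 * k + 2).factorial)) := by
  -- At `x = z` the receding barrier `b + x` equals the remaining time `t - x`; for later reversals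
  -- it is out of reach.
  obtain ⟨z, hz⟩ : ∃ z, z = (t - b) / 2 := ⟨_, rfl⟩
  have hbz : b + z = t - z := by rw [hz]; ring
  have ht : 0 ≤ t := by linarith
  have hcont1 : Continuous fun x => upFactor (k + 1) (b + x) (t - x) / (2 * k + 1).factorial :=
    ((continuous_upFactor (k + 1)).comp
      (by fun_prop : Continuous fun x : ℝ => (b + x, t - x))).div_const _
  let φ : ℝ → ℝ := fun x => if x ≤ z then upFactor (k + 1) (b + x) (t - x) / (2 * k + 1).factorial
    else (t - x) ^ (2 * k + 1) / (2 * k + 1).factorial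
  have heq : ∀ x, x = z → upFactor (k + 1) (b + x) (t - x) / (2 * k + 1).factorial
      = (t - x) ^ (2 * k + 1) / (2 * k + 1).factorial := by
    rintro x rfl
    rw [hbz, upFactor_self]
  have hφ : Continuous φ := hcont1.if_le (by fun_prop) continuous_id continuous_const heq
  have hI1 : ∫ x in (0 : ℝ)..z, φ x
      = (downFactor (k + 1) b t - (t - z) ^ (2 * k + 2)) / (2 * k + 2).factorial := by
    have : ∫ x in (0 : ℝ)..z, φ x
        = ∫ x in (0 : ℝ)..z, upFactor (k + 1) (b + x) (t - x) / (2 * k + 1).factorial := by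
      refine intervalIntegral.integral_congr fun x hx => ?_
      rw [Set.uIcc_of_le (by linarith)] at hx
      exact if_pos hx.2
    rw [this, intervalIntegral.integral_eq_sub_of_hasDerivAt
      (f := fun x => -(downFactor (k + 1) (b + x) (t - x) / (2 * k + 2).factorial)) _
      (hcont1.intervalIntegrable _ _)]
    · simp only [hbz, downFactor_self, add_zero, sub_zero]
      ring
    · intro x _
      refine ((hasDerivAt_downFactor (k + 1) b t x).div_const
        ((2 * k + 2).factorial : ℝ)).neg.congr_deriv ?_
      rw [Nat.factorial_succ (2 * k + 1)]
      have : ((2 * k + 1).factorial : ℝ) ≠ 0 := by positivity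
      push_cast
      field_simp
      ring
  have hI2 : ∫ x in z..t, φ x = (t - z) ^ (2 * k + 2) / (2 * k + 2).factorial := by
    rw [← integral_sub_pow_div_factorial (2 * k + 1) z t]
    refine intervalIntegral.integral_congr fun x hx => ?_
    rw [Set.uIcc_of_le (by linarith)] at hx
    by_cases hxz : x ≤ z
    · exact (if_pos hxz).trans (heq x (le_antisymm hxz hx.1))
    · exact if_neg hxz
  have hI : ∫ x in (0 : ℝ)..t, φ x = downFactor (k + 1) b t / (2 * k + 2).factorial := by
    rw [← intervalIntegral.integral_add_adjacent_intervals (hφ.intervalIntegrable 0 z)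
      (hφ.intervalIntegrable z t), hI1, hI2]
    ring
  rw [← hI]
  -- The point `z` is excluded: there barrier equals horizon, which neither strict case covers.
  refine belowMeasure_succ_eq hr (2 * k + 1) ht ?_ (hφ.intervalIntegrable _ _) ?_ z ?_
  · intro x hx hxt
    exact ⟨fun h => lt_of_le_of_ne h.1 hxt, fun h => ⟨h.le, hb, by linarith⟩⟩
  · intro x hx
    have h1 : 0 ≤ t - x := by linarith [hx.2]
    simp only [φ]
    split_ifs with hxz
    · have := upFactor_nonneg (k + 1) (b := b + x) (t := t - x) (by linarith [hx.1]) (by linarith)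
      positivity
    · positivity
  · intro x hx hxz
    have h1 : b - -1 * x = b + x := by ring
    rw [neg_neg, h1]
    rcases lt_or_gt_of_ne hxz with hlt | hgt
    · simp only [φ, if_pos hlt.le]
      exact ih (by linarith [hx.1]) (by linarith)
    · simp only [φ, if_neg (not_le.2 hgt)]
      exact belowMeasure_of_lt hr _ (by simp) (by linarith [hx.2]) (by linarith)

lemma belowMeasure_down {r : ℝ} (hr : 0 < r) (k : ℕ) {b t : ℝ} (hb : 0 < b) (hbt : b < t) :
    belowMeasure r (2 * k) (-1) b t = ENNReal.ofReal (r ^ (2 * k) * Real.exp (-(r * t))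
      * (downFactor k b t / (2 * k).factorial)) := by
  induction k generalizing b t with
  | zero =>
    rw [mul_zero, belowMeasure_zero hr (by linarith) hb (by linarith)]
    simp [downFactor, upFactor, centralCoeff_zero]
  | succ k ih =>
    exact belowMeasure_down_succ hr k hb hbt fun hb hbt => belowMeasure_up hr k hb hbt ih

/-- The recursion of `upFactor` unrolled; the factor `t ^ 2` avoids the exponent `2 * k - 2`. -/
lemma upFactor_mul_sq (k : ℕ) {b t : ℝ} (ht : t ≠ 0) :
    upFactor k b t * t ^ 2 = t ^ (2 * k) * (b * ∑ j ∈ Finset.range k,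
      ((t ^ 2 - b ^ 2) / t ^ 2) ^ j * centralCoeff j) := by
  induction k with
  | zero => simp [upFactor]
  | succ k ih =>
    have h : t ^ (2 * k) * ((t ^ 2 - b ^ 2) / t ^ 2) ^ k = (t ^ 2 - b ^ 2) ^ k := by
      rw [div_pow, ← pow_mul]
      field_simp
    rw [Finset.sum_range_succ, upFactor]
    linear_combination t ^ 2 * ih - t ^ 2 * b * centralCoeff k * h

/-! ### Waiting times as functions of the Poisson path -/

/-- The first time at which the path `f` has reached the level `m`, computed along rational
times. -/
noncomputable def hittingTime (m : ℕ) (f : ℝ≥0 → ℕ) : ℝ≥0∞ :=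
  ⨅ q : ℚ, if m ≤ f (Real.toNNReal q) then (Real.toNNReal q : ℝ≥0∞) else ⊤

lemma measurable_hittingTime (m : ℕ) : Measurable (hittingTime m) := by
  refine Measurable.iInf fun q => Measurable.ite ?_ measurable_const measurable_const
  exact measurableSet_le measurable_const (measurable_pi_apply _)

lemma hittingTime_eq {m : ℕ} {f : ℝ≥0 → ℕ} {T : ℝ} (hf : ∀ s : ℝ≥0, m ≤ f s ↔ T ≤ s) :
    hittingTime m f = ENNReal.ofReal T := by
  refine le_antisymm (le_of_forall_gt fun y hy => ?_) (le_iInf fun q => ?_)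
  · obtain ⟨q, -, h1, h2⟩ := ENNReal.lt_iff_exists_rat_btwn.1 hy
    refine (iInf_le _ q).trans_lt ?_
    rw [if_pos]
    · exact h2
    · rw [hf]
      exact (Real.le_coe_toNNReal T).trans (by exact_mod_cast (ENNReal.coe_lt_coe.1 h1).le)
  · split_ifs with h
    · rw [hf] at h
      exact ENNReal.coe_le_coe.2 (Real.toNNReal_le_iff_le_coe.2 h)
    · exact le_top

/-- The last clause recovers the waiting times measurably from `N`, since the initial velocity is
assumed independent of `N` and not of `ξ`. -/
lemma IsPoissonProcess.exists_counts {Ω : Type*} [MeasurableSpace Ω] {P : Measure Ω}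
    {r : ℝ} (hr : 0 < r) {N : ℝ≥0 → Ω → ℕ}
    (h : IsPoissonProcess r N P) :
    ∃ ξ : ℕ → Ω → ℝ, (∀ i, Measurable (ξ i)) ∧ iIndepFun ξ P ∧
      (∀ i, P.map (ξ i) = expMeasure r) ∧
      (∀ᵐ ω ∂P, Counts (fun s => N s.toNNReal ω) (fun i => ξ i ω)) ∧
      ∀ᵐ ω ∂P, ∀ i, ξ i ω
        = (hittingTime (i + 1) fun t => N t ω).toReal - (hittingTime i fun t => N t ω).toReal := by
  obtain ⟨-, ξ, hm, hi, hlaw, hc⟩ := h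
  have hprob := isProbabilityMeasure_expMeasure hr
  have hpos : ∀ᵐ ω ∂P, ∀ i, 0 < ξ i ω := by
    refine ae_all_iff.2 fun i => ?_
    have h0 : ∀ᵐ x ∂(expMeasure r), 0 < x := by
      have hI : expMeasure r (Set.Iic 0) = 0 := by
        rw [← ofReal_measureReal, ← cdf_eq_real, cdf_expMeasure_eq hr]
        simp
      rw [ae_iff]
      convert hI using 2
      ext x
      simp
    rw [← hlaw i] at h0
    exact ae_of_ae_map (hm i).aemeasurable h0
  have hN : ∀ᵐ ω ∂P, Counts (fun s => N s.toNNReal ω) (fun i => ξ i ω) := by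
    filter_upwards [hc, hpos] with ω hω hp
    refine ⟨fun a b hab => ?_, hp, fun s hs m => ?_⟩
    · refine (hω _ _).2 (((hω _ _).1 le_rfl).trans ?_)
      exact_mod_cast Real.toNNReal_le_toNNReal hab
    · rw [hω, Real.coe_toNNReal s hs]
  refine ⟨ξ, hm, hi, hlaw, hN, ?_⟩
  filter_upwards [hc, hpos] with ω hω hp i
  have hT : ∀ m, (hittingTime m fun t => N t ω).toReal = ∑ j ∈ Finset.range m, ξ j ω := fun m => by
    rw [hittingTime_eq fun s => hω s m, ENNReal.toReal_ofReal]
    exact Finset.sum_nonneg fun j _ => (hp j).le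
  rw [hT, hT, Finset.sum_range_succ]
  ring

/-! ### Probabilities for the telegraph process -/

/-- The path is continuous on a compact interval, so the supremum is attained and the strict
inequality survives. -/
lemma runningMax_telegraph_lt_iff {Ω : Type*} (V₀ : Ω → ℝ) (N : ℝ≥0 → Ω → ℕ) (t : ℝ≥0) (ω : Ω)
    (hN : Monotone fun s : ℝ => N s.toNNReal ω) (β : ℝ) :
    runningMax (telegraph V₀ N) t ω < β ↔
      ∀ s ∈ Set.Icc (0 : ℝ) t, ∫ u in (0 : ℝ)..s, V₀ ω * (-1) ^ N u.toNNReal ω < β := by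
  have hcont : Continuous fun s : ℝ≥0 => telegraph V₀ N s ω :=
    (intervalIntegral.continuous_primitive
      (fun a b => intervalIntegrable_reversals hN (V₀ ω) a b) 0).comp NNReal.continuous_coe
  rw [runningMax, isCompact_Icc.sSup_lt_iff_of_continuous ⟨0, by simp⟩ hcont.continuousOn]
  constructor
  · intro h s hs
    have := h s.toNNReal ⟨zero_le, Real.toNNReal_le_iff_le_coe.2 hs.2⟩
    rwa [telegraph, Real.coe_toNNReal s hs.1] at this
  · intro h s hs
    exact h s ⟨s.2, by exact_mod_cast hs.2⟩

lemma measure_map_pi {Ω : Type*} [MeasurableSpace Ω] {P : Measure Ω} [IsProbabilityMeasure P]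
    {r : ℝ} {ξ : ℕ → Ω → ℝ} (hm : ∀ i, Measurable (ξ i)) (hi : iIndepFun ξ P)
    (hlaw : ∀ i, P.map (ξ i) = expMeasure r) (n : ℕ) (v b t : ℝ) :
    P {ω | PathBelow n v b t fun i => ξ i ω} = belowMeasure r n v b t := by
  have h1 := (iIndepFun_iff_map_fun_eq_pi_map (f := fun (i : Fin (n + 1)) => ξ i)
    (fun i => (hm i).aemeasurable)).1 (hi.precomp Fin.val_injective)
  simp only [hlaw] at h1
  have hm' : Measurable fun ω (i : Fin (n + 1)) => ξ i ω := measurable_pi_lambda _ fun i => hm i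
  rw [belowMeasure, ← h1, Measure.map_apply hm'
    (measurableSet_pathBelow n v b t)]
  rfl

lemma measure_runningMax_lt {Ω : Type*} [MeasurableSpace Ω] {P : Measure Ω}
    [IsProbabilityMeasure P] {c r : ℝ} (hc : 0 < c) (hr : 0 < r) {V₀ : Ω → ℝ} {N : ℝ≥0 → Ω → ℕ}
    (hT : IsSymmetricTelegraph c r V₀ N P) (t : ℝ≥0) (n : ℕ) {v : ℝ}
    (hv : P {ω | V₀ ω = c * v} = 1 / 2) (b : ℝ) :
    P ({ω | V₀ ω = c * v ∧ N t ω = n} ∩ {ω | runningMax (telegraph V₀ N) t ω < c * b})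
      = 1 / 2 * belowMeasure r n v b t := by
  obtain ⟨ξ, hm, hi, hlaw, hN, hξ⟩ := hT.poisson.exists_counts hr
  have hind : IndepFun V₀ (fun ω (i : Fin (n + 1)) => ξ i ω) P := by
    let g : (ℝ≥0 → ℕ) → Fin (n + 1) → ℝ := fun f i =>
      (hittingTime (i + 1) f).toReal - (hittingTime i f).toReal
    have hg : Measurable g := measurable_pi_lambda _ fun i =>
      (measurable_hittingTime _).ennreal_toReal.sub (measurable_hittingTime _).ennreal_toReal
    refine (hT.indep.comp measurable_id hg).congr Filter.EventuallyEq.rfl ?_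
    filter_upwards [hξ] with ω hω
    funext i
    exact (hω i).symm
  have hae : ({ω | V₀ ω = c * v ∧ N t ω = n}
      ∩ {ω | runningMax (telegraph V₀ N) t ω < c * b} : Set Ω)
      =ᵐ[P] (V₀ ⁻¹' {c * v} ∩ (fun ω (i : Fin (n + 1)) => ξ i ω) ⁻¹' {x | PathBelow n v b t x}
        : Set Ω) := by
    rw [Filter.eventuallyEq_set]
    filter_upwards [hN] with ω hω
    simp only [Set.mem_inter_iff, Set.mem_ofPred_eq, Set.mem_preimage, Set.mem_singleton_iff,
      and_assoc]
    refine and_congr_right fun hV => ?_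
    rw [runningMax_telegraph_lt_iff V₀ N t ω hω.1, ← pathBelow_scale hc,
      hω.pathBelow_iff n (c * v) (c * b) t.coe_nonneg, hV]
    simp
  rw [measure_congr hae, hind.measure_inter_preimage_eq_mul _ _ (measurableSet_singleton _)
    (measurableSet_pathBelow n v b t), ← measure_map_pi hm hi hlaw]
  congr 1

lemma runningMax_lt_of_lt {Ω : Type*} (V₀ : Ω → ℝ) (N : ℝ≥0 → Ω → ℕ) (t : ℝ≥0) (ω : Ω)
    (hN : Monotone fun s : ℝ => N s.toNNReal ω) {β : ℝ} (hβ : |V₀ ω| * t < β) :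
    runningMax (telegraph V₀ N) t ω < β := by
  rw [runningMax_telegraph_lt_iff V₀ N t ω hN]
  intro s hs
  have h := intervalIntegral.norm_integral_le_of_norm_le_const (a := 0) (b := s) (C := |V₀ ω|)
    (f := fun u : ℝ => V₀ ω * (-1 : ℝ) ^ N u.toNNReal ω) (fun u _ => by simp)
  rw [sub_zero, abs_of_nonneg hs.1] at h
  refine ((Real.le_norm_self _).trans h).trans_lt (lt_of_le_of_lt ?_ hβ)
  exact mul_le_mul_of_nonneg_left hs.2 (abs_nonneg _)

lemma measure_velocity_count {Ω : Type*} [MeasurableSpace Ω] {P : Measure Ω}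
    [IsProbabilityMeasure P] {c r : ℝ} (hc : 0 < c) (hr : 0 < r) {V₀ : Ω → ℝ} {N : ℝ≥0 → Ω → ℕ}
    (hT : IsSymmetricTelegraph c r V₀ N P) (t : ℝ≥0) (n : ℕ) {v : ℝ} (hv1 : |v| ≤ 1)
    (hv : P {ω | V₀ ω = c * v} = 1 / 2) :
    P {ω | V₀ ω = c * v ∧ N t ω = n}
      = 1 / 2 * ENNReal.ofReal (r ^ n * Real.exp (-(r * t)) * ((t : ℝ) ^ n / n.factorial)) := by
  -- The unreachable barrier `t + 1` makes the condition on the maximum void.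
  rw [← belowMeasure_of_lt hr n hv1 t.coe_nonneg (lt_add_one (t : ℝ)),
    ← measure_runningMax_lt hc hr hT t n hv]
  obtain ⟨ξ, -, -, -, hN, -⟩ := hT.poisson.exists_counts hr
  refine measure_congr (Filter.eventuallyEq_set.2 ?_)
  filter_upwards [hN] with ω hω
  simp only [Set.mem_inter_iff, Set.mem_ofPred_eq]
  refine ⟨fun h => ⟨h, runningMax_lt_of_lt V₀ N t ω hω.1 ?_⟩, fun h => h.1⟩
  rw [h.1, abs_mul, abs_of_pos hc, mul_assoc]
  refine mul_lt_mul_of_pos_left ?_ hc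
  nlinarith [t.coe_nonneg]

lemma condMaxCDF_eq {Ω : Type*} [MeasurableSpace Ω] {P : Measure Ω}
    [IsProbabilityMeasure P] {c r : ℝ} (hc : 0 < c) (hr : 0 < r) {V₀ : Ω → ℝ} {N : ℝ≥0 → Ω → ℕ}
    (hT : IsSymmetricTelegraph c r V₀ N P) {t : ℝ≥0} (ht : 0 < t) (n : ℕ) {v : ℝ} (hv1 : |v| ≤ 1)
    (hv : P {ω | V₀ ω = c * v} = 1 / 2) {b F : ℝ} (hF : 0 ≤ F)
    (hb : belowMeasure r n v b t
      = ENNReal.ofReal (r ^ n * Real.exp (-(r * t)) * (F / n.factorial))) :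
    condMaxCDF P V₀ N t (c * v) n (c * b) = F / (t : ℝ) ^ n := by
  have hA : MeasurableSet {ω | V₀ ω = c * v ∧ N t ω = n} := by
    rw [Set.ofPred_and]
    exact (hT.measurable_velocity (measurableSet_singleton _)).inter
      (hT.poisson.1 t (measurableSet_singleton _))
  have ht' : (0 : ℝ) < t := ht
  rw [condMaxCDF, measureReal_def, cond_apply hA, measure_runningMax_lt hc hr hT t n hv,
    measure_velocity_count hc hr hT t n hv1 hv, hb, ENNReal.toReal_mul, ENNReal.toReal_inv,
    ENNReal.toReal_mul, ENNReal.toReal_mul, ENNReal.toReal_ofReal (by positivity),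
    ENNReal.toReal_ofReal (by positivity)]
  have : (n.factorial : ℝ) ≠ 0 := by positivity
  have := Real.exp_ne_zero (-(r * t))
  simp only [one_div, ENNReal.toReal_inv, ENNReal.toReal_ofNat]
  field_simp

end Telegraph

theorem mainTheorem8 {Ω : Type*} [MeasurableSpace Ω] (P : Measure Ω) [IsProbabilityMeasure P]
    (c r : ℝ) (hc : 0 < c) (hr : 0 < r) (V₀ : Ω → ℝ) (N : ℝ≥0 → Ω → ℕ)
    (hT : Telegraph.IsSymmetricTelegraph c r V₀ N P)
    (t : ℝ≥0) (β : ℝ) (hβ : 0 < β) (hβt : β < c * t) (k : ℕ) (hk : 1 ≤ k) :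
    Telegraph.condMaxCDF P V₀ N t (-c) (2 * k) β
        = β / (c * t) * ∑ j ∈ Finset.range k,
            ((c ^ 2 * (t : ℝ) ^ 2 - β ^ 2) / (c ^ 2 * (t : ℝ) ^ 2)) ^ j
              * (1 / 2 ^ (2 * j)) * ((2 * j).choose j : ℝ)
          + (c ^ 2 * (t : ℝ) ^ 2 - β ^ 2) ^ k / (2 * c * t) ^ (2 * k) * ((2 * k).choose k : ℝ) ∧
    Telegraph.condMaxCDF P V₀ N t (-c) (2 * k) β
        = Telegraph.condMaxCDF P V₀ N t c (2 * k - 1) β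
          + (c ^ 2 * (t : ℝ) ^ 2 - β ^ 2) ^ k / (2 * c * t) ^ (2 * k)
            * ((2 * k).choose k : ℝ) := by
  -- Reduction to unit speed.
  obtain ⟨b, rfl⟩ : ∃ b, β = c * b := ⟨β / c, by field_simp⟩
  have hb : 0 < b := pos_of_mul_pos_right hβ hc.le
  have hbt : b < t := lt_of_mul_lt_mul_left hβt hc.le
  have ht : (0 : ℝ) < t := hb.trans hbt
  obtain ⟨m, rfl⟩ := Nat.exists_eq_add_of_le' hk
  have hX : c ^ 2 * (t : ℝ) ^ 2 - (c * b) ^ 2 = c ^ 2 * ((t : ℝ) ^ 2 - b ^ 2) := by ring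
  have hdown := Telegraph.condMaxCDF_eq hc hr hT (t := t) ht (2 * (m + 1)) (v := -1) (by simp)
    (by simpa using hT.prob_left) (Telegraph.downFactor_nonneg (m + 1) hb.le hbt.le)
    (Telegraph.belowMeasure_down hr (m + 1) hb hbt)
  have hup := Telegraph.condMaxCDF_eq hc hr hT (t := t) ht (2 * m + 1) (v := 1) (by simp)
    (by simpa using hT.prob_right) (Telegraph.upFactor_nonneg (m + 1) hb.le hbt.le)
    (Telegraph.belowMeasure_up hr m hb hbt fun hb hbt => Telegraph.belowMeasure_down hr m hb hbt)
  have hsum := Telegraph.upFactor_mul_sq (m + 1) (b := b) ht.ne'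
  have hterm : (c ^ 2 * (t : ℝ) ^ 2 - (c * b) ^ 2) ^ (m + 1) / (2 * c * t) ^ (2 * (m + 1))
      * ((2 * (m + 1)).choose (m + 1) : ℝ)
      = Telegraph.centralCoeff (m + 1) * ((t : ℝ) ^ 2 - b ^ 2) ^ (m + 1) / t ^ (2 * (m + 1)) := by
    rw [hX, Telegraph.centralCoeff, Nat.centralBinom, pow_mul (2 * c * t), pow_mul (t : ℝ),
      mul_pow (2 * c), mul_pow 2 c, mul_pow, mul_pow (2 ^ 2 * c ^ 2), mul_pow (2 ^ 2 : ℝ)]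
    norm_num
    field_simp
  have hS : ∀ j, ((c ^ 2 * (t : ℝ) ^ 2 - (c * b) ^ 2) / (c ^ 2 * (t : ℝ) ^ 2)) ^ j
      * (1 / 2 ^ (2 * j)) * ((2 * j).choose j : ℝ)
      = (((t : ℝ) ^ 2 - b ^ 2) / t ^ 2) ^ j * Telegraph.centralCoeff j := fun j => by
    rw [hX, mul_div_mul_left _ _ (by positivity), Telegraph.centralCoeff, Nat.centralBinom, pow_mul]
    norm_num
    ring
  rw [mul_neg_one] at hdown
  rw [mul_one] at hup
  have hn : 2 * (m + 1) - 1 = 2 * m + 1 := by omega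
  rw [hn, hterm, hdown, hup, Finset.sum_congr rfl fun j _ => hS j, Telegraph.downFactor]
  refine ⟨?_, ?_⟩
  · rw [mul_div_mul_left _ _ hc.ne']
    have h2 : t * Telegraph.upFactor (m + 1) b t = t ^ (2 * (m + 1)) * (b / t *
        ∑ j ∈ Finset.range (m + 1), (((t : ℝ) ^ 2 - b ^ 2) / t ^ 2) ^ j
          * Telegraph.centralCoeff j) := by
      field_simp
      linear_combination hsum
    rw [h2]
    field_simp
  · rw [add_div]
    congr 1
    rw [show 2 * (m + 1) = 2 * m + 1 + 1 by ring, pow_succ]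
    field_simp
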